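/- Let $E$ be a real Banach space, let $D\subset E^*$ be a convex weak$^*$-compact set with $0\notin D$, and let $B\subset E^*$. For $x\in E$ and $S\subset E^*$ write $\sup(x,S):=\sup\{\langle x,f\rangle : f\in S\}\in[-\infty,+\infty]$. Put $L_D:=\{x\in E : \sup(x,D)<0\}$ if $D\neq\emptyset$, and $L_D:=E\setminus\{0\}$ if $D=\emptyset$. A sequence $(y_n)_{n\in\mathbb N}$ in $E$ is called a convex block subsequence of $(x_n)_{n\in\mathbb N}$ if there are pairwise disjoint finite sets $A_n\subset\mathbb N$ and real numbers $\lambda_k\ge 0$ such that, for each $n$, $\sum_{k\in A_n}\lambda_k=1$ and $y_n=\sum_{k\in A_n}\lambda_k x_k$. Assume that (i) for each $x\in L_D$ there is $b^*\in B$ with $\langle x,b^*\rangle=\sup(x,B)$; (ii) every bounded sequence $(x_n)_{n\in\mathbb N}$ in $E$ has a convex block subsequence $(y_n)_{n\in\mathbb N}$ which converges pointwise on $B\cup D$ to an element of $E$, that is, there is $y\in E$ with $\langle y_n,f\rangle\to\langle y,f\rangle$ for all $f\in B\cup D$. Then $$\overline{\operatorname{co}(B)}^{\,w^*}=\overline{\operatorname{co}(B)}^{\,\|\cdot\|}.$$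 -/

import Mathlib

open Set Filter Topology

/-- `sup (x, S)`: the supremum of `x` over a set `S` of functionals, in the extended reals. -/
noncomputable def supOn {E : Type*} [NormedAddCommGroup E] [NormedSpace ℝ E]
    (x : E) (S : Set (StrongDual ℝ E)) : EReal :=
  ⨆ f ∈ S, ((f x : ℝ) : EReal)

/-- The set of directions `L_D` in `E`: the points `x` with `sup (x, D) < 0` if `D` is nonempty,
and by convention all nonzero points if `D` is empty. -/
def directionSet {E : Type*} [NormedAddCommGroup E] [NormedSpace ℝ E]
    (D : Set (StrongDual ℝ E)) : Set E :=
  {x | (D = ∅ ∧ x ≠ 0) ∨ (D.Nonempty ∧ supOn x D < 0)}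

/-- `y` is a convex block subsequence of `x`: `y n = ∑ k ∈ A n, c k • x k` for pairwise disjoint
finite sets `A n` of indices and coefficients `c k ≥ 0` which sum to one over every `A n`. -/
def IsConvexBlockSubseq {E : Type*} [AddCommGroup E] [Module ℝ E] (y x : ℕ → E) : Prop :=
  ∃ (A : ℕ → Finset ℕ) (c : ℕ → ℝ),
    (∀ m n, m ≠ n → Disjoint (A m) (A n)) ∧ (∀ k, 0 ≤ c k) ∧
    ∀ n, ∑ k ∈ A n, c k = 1 ∧ y n = ∑ k ∈ A n, c k • x k

/-- Convergence of the sequence `y` to the point `z` of `E` for `σ(E, S)`, the topology of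
pointwise convergence on a set `S` of functionals. -/
def SigmaTendsto {E : Type*} [NormedAddCommGroup E] [NormedSpace ℝ E]
    (S : Set (StrongDual ℝ E)) (y : ℕ → E) (z : E) : Prop :=
  ∀ f ∈ S, Tendsto (fun n => f (y n)) atTop (𝓝 (f z))

/-- Compactness of a set of functionals in the weak-star topology. -/
def IsWeakStarCompact {E : Type*} [NormedAddCommGroup E] [NormedSpace ℝ E]
    (S : Set (StrongDual ℝ E)) : Prop :=
  IsCompact (StrongDual.toWeakDual '' S)

/-- The weak-star closure of a set of functionals. -/
def weakStarClosure {E : Type*} [NormedAddCommGroup E] [NormedSpace ℝ E]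
    (S : Set (StrongDual ℝ E)) : Set (StrongDual ℝ E) :=
  StrongDual.toWeakDual ⁻¹' closure (StrongDual.toWeakDual '' S)

/-! Suppose φ lies in the weak-star closure of co(B) but not in its norm closure. Hahn-Banach gives
g in the bidual and α < β with g < α on co(B) and g(φ) > β. Weak-star approximation of φ and
Goldstine's theorem for g, used alternately, produce b_n in co(B) and a bounded sequence x_n in E
with b_k(x_n) ≤ α for k ≤ n and b_n(x_k) > β for k < n. By Baire, B is uniformly bounded above on a
ball centred at some e in E; together with b_n(e) > φ(e) - 1 this bounds the norms of the b_n. Let c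
be their weak-star limit along an ultrafilter. If convex blocks y_n of x_n converge to z on B ∪ D,
then c(y_n) ≥ β and c(z) ≤ α, so f_n = y_n - z tends to 0 on B ∪ D while c(f_n) ≥ β - α > 0.

Simons' inequality excludes this, although B attains its suprema only in the directions of L_D.
Applied to D, which is weak-star compact, it yields points of the tail hulls of f at which D is
barely positive; adding a small multiple of e moves them into L_D. Applied to B on the hull of the
moved points, it contradicts c ≤ sup(·, B). -/

section

variable {E : Type*} [NormedAddCommGroup E] [NormedSpace ℝ E]

/-! ### Simons' inequality -/

/-- One step of the construction in Simons' inequality: an almost optimal choice in `C`. -/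
theorem exists_almost_minimizer {X : Type*} (C : Set X) (hC : C.Nonempty) (F : X → ℝ) (m : ℝ)
    (hm : ∀ g ∈ C, m ≤ F g) {ε : ℝ} (hε : 0 < ε) :
    ∃ g₀ ∈ C, ∀ g ∈ C, F g₀ ≤ F g + ε := by
  have hbdd : BddBelow (F '' C) := ⟨m, by rintro _ ⟨g, hg, rfl⟩; exact hm g hg⟩
  obtain ⟨_, ⟨g₀, hg₀, rfl⟩, hlt⟩ := Real.lt_sInf_add_pos (hC.image F) hε
  exact ⟨g₀, hg₀, fun g hg => by
    linarith [csInf_le hbdd (mem_image_of_mem F hg)]⟩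

/-- An inequality of Simons for a decreasing sequence of convex sets on whose first member the
supremum over `S` is attained and bounded below by `m`. -/
theorem exists_forall_exists_le_of_attains [CompleteSpace E] (H : ℕ → Set E) (hanti : Antitone H)
    (hne : ∀ n, (H n).Nonempty) (hcl : ∀ n, IsClosed (H n)) (hconv : ∀ n, Convex ℝ (H n))
    (hbdd : Bornology.IsBounded (H 0)) (S : Set (StrongDual ℝ E))
    (hatt : ∀ x ∈ H 0, ∃ b ∈ S, ∀ b' ∈ S, b' x ≤ b x) (m : ℝ)
    (hm : ∀ x ∈ H 0, ∃ b ∈ S, m ≤ b x) {δ : ℝ} (hδ : 0 < δ) :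
    ∃ b ∈ S, ∀ n, ∃ h ∈ H n, m - δ ≤ b h := by
  classical
  obtain ⟨β, hβ⟩ : ∃ β : E → StrongDual ℝ E, ∀ x ∈ H 0, β x ∈ S ∧ ∀ b' ∈ S, b' x ≤ β x x := by
    choose! β hβ using hatt
    exact ⟨β, fun x hx => ⟨(hβ x hx).1, (hβ x hx).2⟩⟩
  have hmβ : ∀ x ∈ H 0, m ≤ β x x := fun x hx => by
    obtain ⟨b, hb, hmb⟩ := hm x hx
    exact hmb.trans ((hβ x hx).2 b hb)
  -- The premise sits inside the statement so that `G` is total. The errors, scaled by 2 ^ n as in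
  -- `hmain`, sum to δ.
  have hstep : ∀ (n : ℕ) (s : E), ∃ g₀ ∈ H n,
      (∀ g ∈ H n, s + (1 / 2 : ℝ) ^ n • g ∈ H 0) → ∀ g ∈ H n,
        β (s + (1 / 2 : ℝ) ^ n • g₀) (s + (1 / 2 : ℝ) ^ n • g₀) ≤
          β (s + (1 / 2 : ℝ) ^ n • g) (s + (1 / 2 : ℝ) ^ n • g) + δ / 2 * (1 / 4) ^ n := by
    intro n s
    by_cases h : ∀ g ∈ H n, s + (1 / 2 : ℝ) ^ n • g ∈ H 0
    · obtain ⟨g₀, hg₀, h₀⟩ := exists_almost_minimizer (H n) (hne n)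
        (fun g => β (s + (1 / 2 : ℝ) ^ n • g) (s + (1 / 2 : ℝ) ^ n • g)) m
        (fun g hg => hmβ _ (h g hg)) (ε := δ / 2 * (1 / 4) ^ n) (by positivity)
      exact ⟨g₀, hg₀, fun _ => h₀⟩
    · obtain ⟨g₀, hg₀⟩ := hne n
      exact ⟨g₀, hg₀, fun h' => absurd h' h⟩
  choose G hG hGmin using hstep
  let s : ℕ → E := fun n => Nat.rec 0 (fun k t => t + (1 / 2 : ℝ) ^ (k + 1) • G k t) n
  have hs0 : s 0 = 0 := rfl
  have hs : ∀ n, s (n + 1) = s n + (1 / 2 : ℝ) ^ (n + 1) • G n (s n) := fun n => rfl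
  have hinv : ∀ n, ∀ g ∈ H n, s n + (1 / 2 : ℝ) ^ n • g ∈ H 0 := by
    intro n
    induction n with
    | zero => intro g hg; simpa [hs0] using hg
    | succ n ih =>
      intro g hg
      have h1 : (1 / 2 : ℝ) • G n (s n) + (1 / 2 : ℝ) • g ∈ H n :=
        hconv n (hG n _) (hanti n.le_succ hg) (by norm_num) (by norm_num) (by norm_num)
      have h2 := ih _ h1
      rw [hs]
      convert h2 using 1
      rw [smul_add, smul_smul, smul_smul, pow_succ]
      abel
  -- The point is a convex combination of h and of the increments chosen at stages n, ..., n + k -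
  -- 1, all of which lie in `H n`.
  have htail : ∀ n k, ∀ h ∈ H (n + k),
      (2 : ℝ) ^ n • (s (n + k) - s n) + (1 / 2 : ℝ) ^ k • h ∈ H n := by
    intro n k
    induction k with
    | zero => intro h hh; simpa using hh
    | succ k ih =>
      intro h hh
      have h1 : (1 / 2 : ℝ) • G (n + k) (s (n + k)) + (1 / 2 : ℝ) • h ∈ H (n + k) :=
        hconv _ (hG _ _) (hanti (Nat.le_succ _) hh) (by norm_num) (by norm_num) (by norm_num)
      have h2 := ih _ h1
      convert h2 using 1
      have e1 : s (n + (k + 1)) = s (n + k) + (1 / 2 : ℝ) ^ (n + k + 1) • G (n + k) (s (n + k)) :=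
        hs (n + k)
      have e2 : (2 : ℝ) ^ n * (1 / 2 : ℝ) ^ (n + k + 1) = (1 / 2) ^ k * (1 / 2) := by
        have : (2 : ℝ) ^ n * (1 / 2 : ℝ) ^ n = 1 := by rw [← mul_pow]; norm_num
        rw [pow_add, pow_add]; linear_combination ((1 / 2 : ℝ) ^ k * (1 / 2)) * this
      rw [e1, add_sub_right_comm, smul_add, smul_smul, e2, smul_add, smul_smul, smul_smul, pow_succ]
      abel
  obtain ⟨R, hR⟩ := hbdd.exists_norm_le
  have hcauchy : CauchySeq s := by
    refine cauchySeq_of_le_geometric (1 / 2) R (by norm_num) fun n => ?_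
    have hGn : ‖G n (s n)‖ ≤ R := hR _ (hanti (Nat.zero_le n) (hG n _))
    have hRn : 0 ≤ R := (norm_nonneg _).trans hGn
    rw [dist_eq_norm, hs, sub_add_cancel_left, norm_neg, norm_smul]
    have : ‖(1 / 2 : ℝ) ^ (n + 1)‖ ≤ (1 / 2) ^ n := by
      rw [Real.norm_of_nonneg (by positivity), pow_succ]
      nlinarith [pow_pos (show (0 : ℝ) < 1 / 2 by norm_num) n]
    calc _ ≤ (1 / 2 : ℝ) ^ n * R := by gcongr
      _ = _ := mul_comm _ _
  obtain ⟨t, ht⟩ := cauchySeq_tendsto_of_complete hcauchy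
  have htn : ∀ n, (2 : ℝ) ^ n • (t - s n) ∈ H n := by
    intro n
    have hlim : Tendsto (fun k => (2 : ℝ) ^ n • (s (n + k) - s n)
        + (1 / 2 : ℝ) ^ k • G (n + k) 0) atTop (𝓝 ((2 : ℝ) ^ n • (t - s n) + 0)) := by
      refine Tendsto.add ?_ ?_
      · have : Tendsto (fun k => s (n + k)) atTop (𝓝 t) := by
          simpa only [add_comm n] using (tendsto_add_atTop_iff_nat n).2 ht
        exact (this.sub_const _).const_smul _
      · refine squeeze_zero_norm (a := fun k => (1 / 2 : ℝ) ^ k * R) (fun k => ?_) ?_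
        · rw [norm_smul, Real.norm_of_nonneg (by positivity)]
          exact mul_le_mul_of_nonneg_left (hR _ (hanti (Nat.zero_le _) (hG _ _))) (by positivity)
        · simpa using (tendsto_pow_atTop_nhds_zero_of_lt_one (r := (1 / 2 : ℝ))
            (by norm_num) (by norm_num)).mul_const R
    rw [add_zero] at hlim
    exact (hcl n).mem_of_tendsto hlim (Eventually.of_forall fun k => htail n k _ (hG _ _))
  have ht0 : t ∈ H 0 := by simpa [hs0] using htn 0
  set b := β t with hb
  have hbS : b ∈ S := (hβ t ht0).1
  -- By `htn`, the limit t is itself a competitor in the minimization at stage n.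
  have hkey : ∀ n, 2 * b (s (n + 1)) - b (s n) ≤ b t + δ / 2 * (1 / 4) ^ n := by
    intro n
    have h1 := hGmin n (s n) (hinv n) _ (htn n)
    have e : s n + (1 / 2 : ℝ) ^ n • (2 : ℝ) ^ n • (t - s n) = t := by
      rw [smul_smul, ← mul_pow]; norm_num
    rw [e] at h1
    have h2 := (hβ _ (hinv n _ (hG n (s n)))).2 b hbS
    have e2 : b (s n + (1 / 2 : ℝ) ^ n • G n (s n)) = 2 * b (s (n + 1)) - b (s n) := by
      rw [hs, map_add, map_add, map_smul, map_smul, smul_eq_mul, smul_eq_mul, pow_succ]; ring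
    linarith
  have hmain : ∀ n : ℕ, m - δ * (1 - (1 / 2) ^ n) ≤ 2 ^ n * (b t - b (s n)) := by
    intro n
    induction n with
    | zero => simpa [hs0] using hmβ t ht0
    | succ n ih =>
      have h1 := mul_le_mul_of_nonneg_left (hkey n) (show (0 : ℝ) ≤ 2 ^ n by positivity)
      have e : (2 : ℝ) ^ n * (1 / 4) ^ n = (1 / 2) ^ n := by rw [← mul_pow]; norm_num
      have e' : (2 : ℝ) ^ n * (b t + δ / 2 * (1 / 4) ^ n) = 2 ^ n * b t + δ / 2 * (1 / 2) ^ n := by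
        rw [← e]; ring
      rw [e'] at h1
      rw [pow_succ, pow_succ]
      linarith
  refine ⟨b, hbS, fun n => ⟨_, htn n, ?_⟩⟩
  rw [map_smul, map_sub, smul_eq_mul]
  have : 0 < δ * (1 / 2 : ℝ) ^ n := by positivity
  linarith [hmain n]

/-! ### Separation, Goldstine's theorem and Baire category -/

/-- Strict separation of a weak-star compact convex set from the origin by a point of `E`. -/
theorem exists_forall_apply_le_neg (D : Set (StrongDual ℝ E))
    (hDconv : Convex ℝ D) (hDcomp : IsWeakStarCompact D) (hD0 : (0 : StrongDual ℝ E) ∉ D) :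
    ∃ x : E, ∃ η > 0, ∀ f ∈ D, f x ≤ -η := by
  have h0 : (0 : WeakDual ℝ E) ∉ StrongDual.toWeakDual '' D := by
    rintro ⟨f, hf, h⟩
    have : f = 0 := by simpa using h
    exact hD0 (this ▸ hf)
  have hconv : Convex ℝ (StrongDual.toWeakDual '' D : Set (WeakDual ℝ E)) :=
    hDconv.linear_image (StrongDual.toWeakDual : StrongDual ℝ E ≃ₗ[ℝ] WeakDual ℝ E).toLinearMap
  have : LocallyConvexSpace ℝ (WeakDual ℝ E) :=
    inferInstanceAs (LocallyConvexSpace ℝ (WeakBilin _))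
  obtain ⟨g, u, hgu, hu0⟩ := geometric_hahn_banach_closed_point hconv hDcomp.isClosed h0
  obtain ⟨x, hx⟩ := LinearMap.dualEmbedding_surjective (topDualPairing ℝ E) g
  rw [map_zero] at hu0
  refine ⟨x, -u, by linarith, fun f hf => ?_⟩
  have := hgu _ (mem_image_of_mem _ hf)
  rw [← hx] at this
  rw [neg_neg]
  exact this.le

theorem IsWeakStarCompact.exists_norm_le [CompleteSpace E] {D : Set (StrongDual ℝ E)}
    (hD : IsWeakStarCompact D) : ∃ C : ℝ, 0 < C ∧ ∀ f ∈ D, ‖f‖ ≤ C := by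
  have h1 : ∀ x : E, ∃ C, ∀ f : D, ‖(f : StrongDual ℝ E) x‖ ≤ C := by
    intro x
    have hc : IsCompact ((fun f : WeakDual ℝ E => f x) '' (StrongDual.toWeakDual '' D)) :=
      hD.image (WeakDual.eval_continuous x)
    obtain ⟨C, hC⟩ := hc.isBounded.exists_norm_le
    exact ⟨C, fun f => hC _ ⟨_, mem_image_of_mem _ f.2, rfl⟩⟩
  obtain ⟨C, hC⟩ := banach_steinhaus h1
  exact ⟨max C 1, by positivity, fun f hf => (hC ⟨f, hf⟩).trans (le_max_left _ _)⟩

/-- A weak-star compact set attains its supremum at every point of `E`. -/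
theorem IsWeakStarCompact.exists_forall_apply_le {D : Set (StrongDual ℝ E)}
    (hD : IsWeakStarCompact D) (hne : D.Nonempty) (x : E) : ∃ f ∈ D, ∀ f' ∈ D, f' x ≤ f x := by
  obtain ⟨_, ⟨f, hf, rfl⟩, h⟩ := hD.exists_isMaxOn (hne.image _)
    (WeakDual.eval_continuous (𝕜 := ℝ) x).continuousOn
  exact ⟨f, hf, fun f' hf' => h (mem_image_of_mem _ hf')⟩

theorem norm_le_div_of_forall_apply_le {f : StrongDual ℝ E} {R u : ℝ} (hR : 0 < R) (hu : 0 ≤ u)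
    (h : ∀ x : E, ‖x‖ ≤ R → f x ≤ u) : ‖f‖ ≤ u / R := by
  refine ContinuousLinearMap.opNorm_le_of_unit_norm (by positivity) fun x hx => ?_
  have h1 := h (R • x) (by rw [norm_smul, hx, Real.norm_of_nonneg hR.le, mul_one])
  have h2 := h (-(R • x)) (by rw [norm_neg, norm_smul, hx, Real.norm_of_nonneg hR.le, mul_one])
  rw [map_neg, map_smul, smul_eq_mul] at h2
  rw [map_smul, smul_eq_mul] at h1
  rw [le_div_iff₀ hR, Real.norm_eq_abs, mul_comm]
  rw [show R * |f x| = |R * f x| by rw [abs_mul, abs_of_pos hR], abs_le]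
  constructor <;> linarith

/-- Goldstine's theorem, in terms of finite sets of functionals. -/
theorem exists_norm_le_forall_abs_apply_sub_lt (g : StrongDual ℝ (StrongDual ℝ E)) {R : ℝ} (hR : ‖g‖ < R)
    (s : Finset (StrongDual ℝ E)) {ε : ℝ} (hε : 0 < ε) :
    ∃ x : E, ‖x‖ ≤ R ∧ ∀ f ∈ s, |f x - g f| < ε := by
  classical
  let T : E →ₗ[ℝ] (s → ℝ) := LinearMap.pi fun f => (f : StrongDual ℝ E).toLinearMap
  have hR0 : 0 < R := (norm_nonneg g).trans_lt hR
  set K : Set (s → ℝ) := closure (T '' Metric.closedBall 0 R) with hK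
  have hKc : Convex ℝ K := ((convex_closedBall 0 R).linear_image T).closure
  have hmem : (fun f : s => g f) ∈ K := by
    by_contra hnot
    obtain ⟨φ, u, h1, h2⟩ := geometric_hahn_banach_closed_point hKc isClosed_closure hnot
    set a : s → ℝ := fun f => φ (Pi.single f 1) with ha
    have hφ : ∀ v : s → ℝ, φ v = ∑ f, v f * a f := by
      intro v
      conv_lhs => rw [← Finset.univ_sum_single v]
      rw [map_sum]
      refine Finset.sum_congr rfl fun f _ => ?_
      rw [ha, ← smul_eq_mul, ← map_smul, ← Pi.single_smul]
      simp
    -- The separating functional on the finite product comes from this combination F; it would give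
    -- u < g F ≤ ‖g‖ ‖F‖ ≤ u.
    set F : StrongDual ℝ E := ∑ f : s, a f • (f : StrongDual ℝ E) with hF
    have hx : ∀ x : E, ‖x‖ ≤ R → F x < u := by
      intro x hx
      have := h1 (T x) (subset_closure (mem_image_of_mem _ (by simpa using hx)))
      rw [hφ] at this
      convert this using 1
      simp [hF, T, mul_comm]
    have hu : 0 < u := by simpa using hx 0 (by simpa using hR0.le)
    have hnorm : ‖F‖ ≤ u / R :=
      norm_le_div_of_forall_apply_le hR0 hu.le fun x h => (hx x h).le

    have hgF : g F = ∑ f : s, g f * a f := by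
      simp [hF, mul_comm]
    rw [hφ, ← hgF] at h2
    have : g F ≤ ‖g‖ * ‖F‖ := (le_abs_self _).trans (g.le_opNorm F)
    have h3 : ‖g‖ * ‖F‖ ≤ R * (u / R) := by gcongr
    rw [mul_div_cancel₀ _ hR0.ne'] at h3
    linarith
  obtain ⟨_, ⟨x, hx, rfl⟩, hd⟩ := Metric.mem_closure_iff.1 hmem ε hε
  refine ⟨x, by simpa using hx, fun f hf => ?_⟩
  have := (dist_pi_lt_iff hε).1 hd ⟨f, hf⟩
  rw [dist_comm, Real.dist_eq] at this
  exact this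

/-- The points at which the functionals in `D` are uniformly negative. -/
def uniformlyNegativeSet (D : Set (StrongDual ℝ E)) : Set E :=
  {x | ∃ η > 0, ∀ f ∈ D, f x ≤ -η}

/-- If the supremum over `B` is finite on the uniformly negative points of a weak-star compact `D`,
then it is bounded above on some ball around such a point. -/
theorem exists_ball_forall_apply_le [CompleteSpace E] {D B : Set (StrongDual ℝ E)}
    (hD : IsWeakStarCompact D) (hne : (uniformlyNegativeSet D).Nonempty)
    (hB : ∀ x ∈ uniformlyNegativeSet D, ∃ M : ℝ, ∀ b ∈ B, b x ≤ M) :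
    ∃ e ∈ uniformlyNegativeSet D, ∃ r > 0, ∃ M : ℝ, ∀ b ∈ B, ∀ v : E, ‖v‖ ≤ r → b (e + v) ≤ M := by
  obtain ⟨x₁, η, hη, hx₁⟩ := hne
  obtain ⟨C, hC0, hC⟩ := hD.exists_norm_le
  set U : Set E := Metric.ball x₁ (η / (2 * C)) with hU
  have hUneg : U ⊆ uniformlyNegativeSet D := by
    intro x hx
    refine ⟨η / 2, by positivity, fun f hf => ?_⟩
    have h1 : f (x - x₁) ≤ C * (η / (2 * C)) :=
      (le_abs_self _).trans <| (f.le_opNorm _).trans <|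
        mul_le_mul (hC f hf) (mem_ball_iff_norm.1 hx).le (norm_nonneg _) hC0.le
    have h2 : C * (η / (2 * C)) = η / 2 := by field_simp
    rw [map_sub] at h1
    linarith [hx₁ f hf]
  -- Adjoining the complement of U makes these closed sets cover E; inside U only the first part
  -- counts.
  let F : ℕ → Set E := fun n => {x | ∀ b ∈ B, b x ≤ n} ∪ Uᶜ
  have hF : ∀ n, IsClosed (F n) := by
    intro n
    refine IsClosed.union ?_ Metric.isOpen_ball.isClosed_compl
    simp only [ofPred_forall]
    exact isClosed_biInter fun b _ => isClosed_le b.continuous continuous_const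
  have hcover : ⋃ n, F n = univ := by
    refine eq_univ_of_forall fun x => mem_iUnion.2 ?_
    by_cases hx : x ∈ U
    · obtain ⟨M, hM⟩ := hB x (hUneg hx)
      obtain ⟨n, hn⟩ := exists_nat_ge M
      exact ⟨n, Or.inl fun b hb => (hM b hb).trans hn⟩
    · exact ⟨0, Or.inr hx⟩
  obtain ⟨e, heU, he⟩ := (dense_iUnion_interior_of_closed hF hcover).inter_open_nonempty U
    Metric.isOpen_ball ⟨x₁, Metric.mem_ball_self (by positivity)⟩
  obtain ⟨n, hn⟩ := mem_iUnion.1 he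
  obtain ⟨r, hr, hball⟩ := Metric.nhds_basis_closedBall.mem_iff.1
    ((isOpen_interior.inter Metric.isOpen_ball).mem_nhds ⟨hn, heU⟩)
  refine ⟨e, hUneg heU, r, hr, n, fun b hb v hv => ?_⟩
  obtain ⟨h1, h2⟩ := hball (show e + v ∈ Metric.closedBall e r by simpa using hv)
  rcases interior_subset h1 with h | h
  · exact h b hb
  · exact absurd h2 h

/-! ### Tail hulls and convex blocks -/

/-- The closed convex hull of a tail of a sequence. -/
def tailHull (f : ℕ → E) (n : ℕ) : Set E := closure (convexHull ℝ (f '' Ici n))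

theorem mem_tailHull (f : ℕ → E) {n k : ℕ} (h : n ≤ k) : f k ∈ tailHull f n :=
  subset_closure (subset_convexHull ℝ _ (mem_image_of_mem f h))

theorem tailHull_subset {f : ℕ → E} {n : ℕ} {C : Set E} (hC : Convex ℝ C) (hcl : IsClosed C)
    (h : ∀ k, n ≤ k → f k ∈ C) : tailHull f n ⊆ C :=
  closure_minimal (convexHull_min (by rintro _ ⟨k, hk, rfl⟩; exact h k hk) hC) hcl

theorem isClosed_tailHull (f : ℕ → E) (n : ℕ) : IsClosed (tailHull f n) := isClosed_closure

theorem convex_tailHull (f : ℕ → E) (n : ℕ) : Convex ℝ (tailHull f n) :=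
  (convex_convexHull ℝ _).closure

theorem tailHull_antitone (f : ℕ → E) : Antitone (tailHull f) := fun _ _ h =>
  tailHull_subset (convex_tailHull f _) (isClosed_tailHull f _) fun _ hk =>
    mem_tailHull f (h.trans hk)

theorem apply_le_of_mem_tailHull {f : ℕ → E} {n : ℕ} (b : StrongDual ℝ E) {t : ℝ}
    (h : ∀ k, n ≤ k → b (f k) ≤ t) {x : E} (hx : x ∈ tailHull f n) : b x ≤ t :=
  tailHull_subset (C := {x | b x ≤ t}) (convex_halfSpace_le b.toLinearMap.isLinear t)
    (isClosed_le b.continuous continuous_const) h hx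

theorem le_apply_of_mem_tailHull {f : ℕ → E} {n : ℕ} (b : StrongDual ℝ E) {t : ℝ}
    (h : ∀ k, n ≤ k → t ≤ b (f k)) {x : E} (hx : x ∈ tailHull f n) : t ≤ b x :=
  tailHull_subset (C := {x | t ≤ b x}) (convex_halfSpace_ge b.toLinearMap.isLinear t)
    (isClosed_le continuous_const b.continuous) h hx

theorem norm_le_of_mem_tailHull {f : ℕ → E} {n : ℕ} {R : ℝ}
    (h : ∀ k, n ≤ k → ‖f k‖ ≤ R) {x : E} (hx : x ∈ tailHull f n) : ‖x‖ ≤ R := by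
  simpa using tailHull_subset (C := Metric.closedBall 0 R) (convex_closedBall 0 R)
    Metric.isClosed_closedBall (fun k hk => by simpa using h k hk) hx

/-- Simons' inequality for the closed convex hulls of the tails of a bounded sequence. -/
theorem exists_frequently_le_of_attains [CompleteSpace E] {f : ℕ → E} {R : ℝ}
    (hf : ∀ k, ‖f k‖ ≤ R) (N : ℕ) (S : Set (StrongDual ℝ E))
    (hatt : ∀ x ∈ tailHull f N, ∃ b ∈ S, ∀ b' ∈ S, b' x ≤ b x) (m : ℝ)
    (hm : ∀ x ∈ tailHull f N, ∃ b ∈ S, m ≤ b x) {t : ℝ}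
    (ht : ∀ b ∈ S, ∀ᶠ k in atTop, b (f k) ≤ t) : m ≤ t := by
  by_contra! hlt
  obtain ⟨b, hb, h⟩ := exists_forall_exists_le_of_attains (fun n => tailHull f (N + n))
    (fun i j hij => tailHull_antitone f (by omega)) (fun n => ⟨_, mem_tailHull f le_rfl⟩)
    (fun n => isClosed_tailHull f _) (fun n => convex_tailHull f _)
    (isBounded_iff_forall_norm_le.2 ⟨R, fun x hx => norm_le_of_mem_tailHull (fun k _ => hf k) hx⟩)
    S hatt m hm (half_pos (sub_pos.2 hlt))
  obtain ⟨n, hn⟩ := eventually_atTop.1 (ht b hb)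
  obtain ⟨x, hx, hle⟩ := h n
  have := apply_le_of_mem_tailHull b (t := t) (fun k hk => hn k (by omega)) hx
  linarith

theorem IsConvexBlockSubseq.mem_of_convex {x y : ℕ → E} (h : IsConvexBlockSubseq y x) {C : Set E}
    (hC : Convex ℝ C) (hx : ∀ k, x k ∈ C) (n : ℕ) : y n ∈ C := by
  obtain ⟨A, c, -, hc, hy⟩ := h
  rw [(hy n).2]
  exact hC.sum_mem (fun k _ => hc k) (hy n).1 fun k _ => hx k

/-- Disjointness puts each index in at most one block, so the blocks eventually avoid any initial
segment. -/
theorem IsConvexBlockSubseq.eventually_mem_of_convex {x y : ℕ → E} (h : IsConvexBlockSubseq y x)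
    {C : Set E} (hC : Convex ℝ C) {K : ℕ} (hx : ∀ k, K ≤ k → x k ∈ C) :
    ∀ᶠ n in atTop, y n ∈ C := by
  obtain ⟨A, c, hA, hc, hy⟩ := h
  have h1 : ∀ k, ∀ᶠ n in atTop, k ∉ A n := by
    intro k
    by_cases hk : ∃ n, k ∈ A n
    · obtain ⟨n, hn⟩ := hk
      filter_upwards [eventually_gt_atTop n] with m hm hkm
      exact Finset.disjoint_left.1 (hA n m hm.ne) hn hkm
    · exact Eventually.of_forall fun n hn => hk ⟨n, hn⟩
  have h2 : ∀ᶠ n in atTop, ∀ k ∈ Finset.range K, k ∉ A n :=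
    (Finset.range K).eventually_all.2 fun k _ => h1 k
  filter_upwards [h2] with n hn
  rw [(hy n).2]
  refine hC.sum_mem (fun k _ => hc k) (hy n).1 fun k hk => hx k ?_
  by_contra! hlt
  exact hn k (Finset.mem_range.2 hlt) hk

/-- A bounded sequence vanishing pointwise on `B ∪ D` cannot stay away from zero under a
functional `c` dominated by the supremum over `B`. -/
theorem nonpos_of_le_apply_of_tendsto_zero [CompleteSpace E] {D B : Set (StrongDual ℝ E)}
    (hD : IsWeakStarCompact D)
    (hatt : ∀ x ∈ uniformlyNegativeSet D, ∃ b ∈ B, ∀ b' ∈ B, b' x ≤ b x)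
    {e : E} (he : e ∈ uniformlyNegativeSet D) {M : ℝ} (hM : ∀ b ∈ B, b e ≤ M)
    {f : ℕ → E} {R : ℝ} (hf : ∀ k, ‖f k‖ ≤ R)
    (hlim : ∀ b ∈ B ∪ D, Tendsto (fun k => b (f k)) atTop (𝓝 0))
    (c : StrongDual ℝ E) (hc : ∀ x t, (∀ b ∈ B, b x ≤ t) → c x ≤ t) {γ : ℝ}
    (hγ : ∀ k, γ ≤ c (f k)) : γ ≤ 0 := by
  by_contra! hγ0
  obtain ⟨η, hη, heη⟩ := he
  have hcM : 0 ≤ M - c e := sub_nonneg.2 (hc e M hM)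
  -- This is exactly what makes ε M + γ / 2 < ε c(e) + γ, against the final inequality `hfin`.
  obtain ⟨ε, hε, hεγ⟩ : ∃ ε > 0, ε * (M - c e) < γ / 2 := by
    refine ⟨γ / (2 * (M - c e + 1)), by positivity, ?_⟩
    rw [div_mul_eq_mul_div, div_lt_div_iff₀ (by positivity) (by positivity)]
    nlinarith
  -- Otherwise the supremum over D stays above ε η / 2 on a whole tail hull, although each d in D
  -- tends to 0 along f.
  have hunif : ∀ N, ∃ h ∈ tailHull f N, ∀ d ∈ D, d h ≤ ε * η / 2 := by
    intro N
    by_contra! hcon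
    have hDne : D.Nonempty := by
      obtain ⟨d, hd, -⟩ := hcon _ (mem_tailHull f le_rfl)
      exact ⟨d, hd⟩
    have hpos : 0 < ε * η / 2 := by positivity
    have := exists_frequently_le_of_attains hf N D
      (fun x _ => hD.exists_forall_apply_le hDne x) (ε * η / 2)
      (fun x hx => by obtain ⟨d, hd, h⟩ := hcon x hx; exact ⟨d, hd, h.le⟩)
      (t := ε * η / 2 / 2)
      (fun d hd => ((hlim d (Or.inr hd)).eventually_lt_const (half_pos hpos)).mono fun _ h => h.le)
    linarith
  choose h hh hhD using hunif
  have hhc : ∀ k, γ ≤ c (h k) := fun k => le_apply_of_mem_tailHull c (fun j _ => hγ j) (hh k)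
  have hhR : ∀ k, ‖h k‖ ≤ R := fun k => norm_le_of_mem_tailHull (fun j _ => hf j) (hh k)
  have hhB : ∀ b ∈ B, ∀ τ > 0, ∀ᶠ k in atTop, b (h k) ≤ τ := by
    intro b hb τ hτ
    obtain ⟨n, hn⟩ := eventually_atTop.1 ((hlim b (Or.inl hb)).eventually_lt_const hτ)
    filter_upwards [eventually_ge_atTop n] with k hk
    exact apply_le_of_mem_tailHull b (fun j hj => (hn j (hk.trans hj)).le) (hh k)
  have hneg : ∀ x ∈ tailHull (fun k => ε • e + h k) 0, x ∈ uniformlyNegativeSet D := by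
    intro x hx
    refine ⟨ε * η / 2, by positivity, fun d hd => ?_⟩
    refine apply_le_of_mem_tailHull d (fun k _ => ?_) hx
    have := mul_le_mul_of_nonneg_left (heη d hd) hε.le
    rw [map_add, map_smul, smul_eq_mul]
    linarith [hhD k d hd]
  have hfin := exists_frequently_le_of_attains (f := fun k => ε • e + h k) (R := ‖ε • e‖ + R)
    (fun k => (norm_add_le _ _).trans (by linarith [hhR k])) 0 B
    (fun x hx => hatt x (hneg x hx)) (ε * c e + γ)
    (fun x hx => by
      obtain ⟨b, hb, hle⟩ := hatt x (hneg x hx)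
      refine ⟨b, hb, le_trans ?_ (hc x (b x) hle)⟩
      refine le_apply_of_mem_tailHull c (fun k _ => ?_) hx
      rw [map_add, map_smul, smul_eq_mul]
      linarith [hhc k])
    (t := ε * M + γ / 2)
    (fun b hb => by
      filter_upwards [hhB b hb (γ / 2) (by positivity)] with k hk
      have := mul_le_mul_of_nonneg_left (hM b hb) hε.le
      rw [map_add, map_smul, smul_eq_mul]
      linarith)
  linarith

/-! ### Interlacing sequences and weak-star limits -/

theorem exists_forall_lt_apply_of_mem_weakStarClosure {K : Set (StrongDual ℝ E)}
    {φ : StrongDual ℝ E} (hφ : φ ∈ weakStarClosure K) {ι : Type*} (s : Finset ι) (x : ι → E)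
    (t : ι → ℝ) (h : ∀ i ∈ s, t i < φ (x i)) : ∃ b ∈ K, ∀ i ∈ s, t i < b (x i) := by
  have hev : ∀ᶠ ψ : WeakDual ℝ E in 𝓝 (StrongDual.toWeakDual φ), ∀ i ∈ s, t i < ψ (x i) :=
    s.eventually_all.2 fun i hi =>
      (WeakDual.eval_continuous (𝕜 := ℝ) (x i)).continuousAt.eventually_const_lt (h i hi)
  have hcl : StrongDual.toWeakDual φ ∈ closure (StrongDual.toWeakDual '' K) := hφ
  obtain ⟨_, h1, ⟨b, hb, rfl⟩⟩ := mem_closure_iff_nhds.1 hcl _ hev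
  exact ⟨b, hb, h1⟩

/-- A point of the weak-star closure of `K` which an element of the bidual separates from `K` is
approximated by a sequence in `K` that interlaces with a bounded sequence in `E`. -/
theorem exists_interlacing_sequences {K : Set (StrongDual ℝ E)} {φ : StrongDual ℝ E}
    (hφ : φ ∈ weakStarClosure K) (g : StrongDual ℝ (StrongDual ℝ E)) {α β : ℝ}
    (hα : ∀ b ∈ K, g b < α) (hβ : β < g φ) (e : E) :
    ∃ (b : ℕ → StrongDual ℝ E) (x : ℕ → E), (∀ n, b n ∈ K) ∧ (∀ n, ‖x n‖ ≤ ‖g‖ + 1) ∧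
      (∀ n, φ e - 1 < b n e) ∧ (∀ k n, k ≤ n → b k (x n) ≤ α) ∧ ∀ k n, k < n → β < b n (x k) := by
  classical
  obtain ⟨p, hP, hr⟩ := exists_seq_of_forall_finset_exists
    (fun p : StrongDual ℝ E × E => p.1 ∈ K ∧ ‖p.2‖ ≤ ‖g‖ + 1 ∧ φ e - 1 < p.1 e ∧ p.1 p.2 ≤ α ∧
      β < φ p.2)
    (fun p q => p.1 q.2 ≤ α ∧ β < q.1 p.2) (by
      intro s hs
      -- The index `none` carries the test at e; the others carry the earlier points of E.
      obtain ⟨b, hbK, hb⟩ := exists_forall_lt_apply_of_mem_weakStarClosure hφ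
        (insert none (s.image some)) (fun o : Option (StrongDual ℝ E × E) => o.elim e Prod.snd)
        (fun o => o.elim (φ e - 1) fun _ => β) (by
          intro o ho
          rcases o with _ | p
          · simp
          · exact (hs p (by simpa using ho)).2.2.2.2)
      -- Only finitely many strict inequalities for g are involved, so a common slack ε survives
      -- replacing g by a point of E.
      have hev : ∃ ε > 0, (∀ f ∈ insert b (s.image Prod.fst), g f + ε ≤ α) ∧ β + ε ≤ g φ := by
        have h1 : ∀ᶠ ε in 𝓝[>] (0 : ℝ), ∀ f ∈ insert b (s.image Prod.fst), g f + ε ≤ α := by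
          refine (Finset.eventually_all _).2 fun f hf => ?_
          have hfα : g f < α := by
            rcases Finset.mem_insert.1 hf with rfl | hf
            · exact hα _ hbK
            · obtain ⟨p, hp, rfl⟩ := Finset.mem_image.1 hf
              exact hα _ (hs p hp).1
          filter_upwards [nhdsWithin_le_nhds (eventually_le_nhds (sub_pos.2 hfα))] with ε hε
          linarith
        have h2 : ∀ᶠ ε in 𝓝[>] (0 : ℝ), β + ε ≤ g φ := by
          filter_upwards [nhdsWithin_le_nhds (eventually_le_nhds (sub_pos.2 hβ))] with ε hε
          linarith
        obtain ⟨ε, ⟨h1, h2⟩, h3⟩ := ((h1.and h2).and self_mem_nhdsWithin).exists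
        exact ⟨ε, h3, h1, h2⟩
      obtain ⟨ε, hε, hεα, hεβ⟩ := hev
      obtain ⟨x, hxR, hx⟩ := exists_norm_le_forall_abs_apply_sub_lt g (lt_add_one ‖g‖)
        (insert φ (insert b (s.image Prod.fst))) hε
      have hxα : ∀ f ∈ insert b (s.image Prod.fst), f x ≤ α := fun f hf => by
        linarith [(abs_lt.1 (hx f (Finset.mem_insert_of_mem hf))).2, hεα f hf]
      refine ⟨(b, x), ⟨hbK, hxR, ?_, hxα b (Finset.mem_insert_self _ _), ?_⟩, fun p hp => ⟨?_, ?_⟩⟩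
      · simpa using hb none (Finset.mem_insert_self _ _)
      · linarith [(abs_lt.1 (hx φ (Finset.mem_insert_self _ _))).1]
      · exact hxα _ (Finset.mem_insert_of_mem (Finset.mem_image_of_mem _ hp))
      · exact hb (some p) (by simpa using hp))
  refine ⟨fun n => (p n).1, fun n => (p n).2, fun n => (hP n).1, fun n => (hP n).2.1,
    fun n => (hP n).2.2.1, fun k n hkn => ?_, fun k n hkn => (hr k n hkn).2⟩
  rcases hkn.eq_or_lt with rfl | h
  · exact (hP k).2.2.2.1
  · exact (hr k n h).1

/-- A bounded sequence of functionals has a weak-star limit along any ultrafilter. -/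
theorem exists_forall_tendsto_apply_ultrafilter {b : ℕ → StrongDual ℝ E} {C : ℝ}
    (hb : ∀ n, ‖b n‖ ≤ C) (u : Ultrafilter ℕ) :
    ∃ c : StrongDual ℝ E, ∀ x, Tendsto (fun n => b n x) u (𝓝 (c x)) := by
  obtain ⟨c, -, hc⟩ :=
    (WeakDual.isCompact_closedBall (𝕜 := ℝ) (0 : StrongDual ℝ E) C).ultrafilter_le_nhds
    (u.map fun n => StrongDual.toWeakDual (b n)) (by
      rw [le_principal_iff]
      exact Ultrafilter.mem_map.2 (univ_mem' fun n => by simpa using hb n))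
  exact ⟨WeakDual.toStrongDual c, fun x =>
    ((WeakDual.eval_continuous (𝕜 := ℝ) x).tendsto c).comp hc⟩

theorem apply_le_of_mem_convexHull {B : Set (StrongDual ℝ E)} {x : E} {t : ℝ}
    (h : ∀ b ∈ B, b x ≤ t) {b : StrongDual ℝ E} (hb : b ∈ convexHull ℝ B) : b x ≤ t :=
  convexHull_min (t := {b : StrongDual ℝ E | b x ≤ t}) h
    (convex_halfSpace_le ((ContinuousLinearMap.apply ℝ ℝ x).toLinearMap.isLinear) t) hb

theorem tendsto_apply_of_mem_convexHull {B : Set (StrongDual ℝ E)} {y : ℕ → E} {z : E}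
    (h : ∀ b ∈ B, Tendsto (fun n => b (y n)) atTop (𝓝 (b z))) {b : StrongDual ℝ E}
    (hb : b ∈ convexHull ℝ B) : Tendsto (fun n => b (y n)) atTop (𝓝 (b z)) :=
  convexHull_min (t := {b : StrongDual ℝ E | Tendsto (fun n => b (y n)) atTop (𝓝 (b z))}) h
    (fun f hf f' hf' p q _ _ _ => by
      simpa using (Tendsto.const_mul p hf).add (Tendsto.const_mul q hf')) hb

theorem closure_subset_weakStarClosure (K : Set (StrongDual ℝ E)) :
    closure K ⊆ weakStarClosure K := fun _ hφ =>
  image_closure_subset_closure_image NormedSpace.Dual.toWeakDual_continuous (mem_image_of_mem _ hφ)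

/-- When D is empty, 0 is uniformly negative but not a direction; there any member of B attains the
supremum. -/
theorem exists_attains_of_mem_uniformlyNegativeSet {D B : Set (StrongDual ℝ E)} (hB : B.Nonempty)
    (hattain : ∀ x ∈ directionSet D, ∃ b ∈ B, ((b x : ℝ) : EReal) = supOn x B) {x : E}
    (hx : x ∈ uniformlyNegativeSet D) : ∃ b ∈ B, ∀ b' ∈ B, b' x ≤ b x := by
  have key : x ∈ directionSet D → ∃ b ∈ B, ∀ b' ∈ B, b' x ≤ b x := by
    intro h
    obtain ⟨b, hb, heq⟩ := hattain x h
    refine ⟨b, hb, fun b' hb' => ?_⟩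
    rw [← EReal.coe_le_coe_iff, heq]
    exact le_iSup₂ (f := fun (f : StrongDual ℝ E) (_ : f ∈ B) => ((f x : ℝ) : EReal)) b' hb'
  rcases D.eq_empty_or_nonempty with hD | hD
  · by_cases h0 : x = 0
    · obtain ⟨b, hb⟩ := hB
      exact ⟨b, hb, fun b' _ => by simp [h0]⟩
    · exact key (Or.inl ⟨hD, h0⟩)
  · obtain ⟨η, hη, h⟩ := hx
    refine key (Or.inr ⟨hD, lt_of_le_of_lt (b := ((-η : ℝ) : EReal)) ?_ ?_⟩)
    · exact iSup₂_le fun f hf => EReal.coe_le_coe_iff.2 (h f hf)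
    · exact_mod_cast neg_lt_zero.2 hη

end

/-! ### The contradiction -/

theorem mainTheorem8 {E : Type*} [NormedAddCommGroup E] [NormedSpace ℝ E] [CompleteSpace E]
    (D B : Set (StrongDual ℝ E))
    (hDconv : Convex ℝ D) (hDcomp : IsWeakStarCompact D) (hD0 : (0 : StrongDual ℝ E) ∉ D)
    (hattain : ∀ x ∈ directionSet D, ∃ b ∈ B, ((b x : ℝ) : EReal) = supOn x B)
    (hblock : ∀ x : ℕ → E, Bornology.IsBounded (range x) →
      ∃ y : ℕ → E, IsConvexBlockSubseq y x ∧ ∃ z : E, SigmaTendsto (B ∪ D) y z) :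
    weakStarClosure (convexHull ℝ B) = closure (convexHull ℝ B) := by
  refine Subset.antisymm (fun φ hφ => ?_) (closure_subset_weakStarClosure _)
  by_contra hnot
  have hBne : B.Nonempty := by
    -- With no test points, the approximation says only that the hull is nonempty.
    obtain ⟨b, hb, -⟩ := exists_forall_lt_apply_of_mem_weakStarClosure hφ
      (∅ : Finset ℕ) (fun _ => 0) (fun _ => 0) (by simp)
    exact convexHull_nonempty_iff.1 ⟨b, hb⟩
  have hatt : ∀ x ∈ uniformlyNegativeSet D, ∃ b ∈ B, ∀ b' ∈ B, b' x ≤ b x := fun x hx =>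
    exists_attains_of_mem_uniformlyNegativeSet hBne hattain hx
  obtain ⟨e, he, r, hr, M, hM⟩ := exists_ball_forall_apply_le hDcomp
    (exists_forall_apply_le_neg D hDconv hDcomp hD0)
    (fun x hx => by obtain ⟨b, -, h⟩ := hatt x hx; exact ⟨b x, h⟩)
  obtain ⟨g, α, hα, hαφ⟩ :=
    geometric_hahn_banach_closed_point (convex_convexHull ℝ B).closure isClosed_closure hnot
  obtain ⟨β, hαβ, hβ⟩ := exists_between hαφ
  obtain ⟨b, x, hbK, hxR, hbe, hbα, hbβ⟩ := exists_interlacing_sequences hφ g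
    (fun b hb => hα b (subset_closure hb)) hβ e
  have hbM : ∀ n v, ‖v‖ ≤ r → b n (e + v) ≤ M := fun n v hv =>
    apply_le_of_mem_convexHull (fun b hb => hM b hb v hv) (hbK n)
  have hbe' : ∀ n, b n e ≤ M := fun n => by simpa using hbM n 0 (by simpa using hr.le)
  have hbC : ∀ n, ‖b n‖ ≤ (M - φ e + 1) / r := fun n =>
    norm_le_div_of_forall_apply_le hr (by linarith [hbe n, hbe' n]) fun v hv => by
      have := hbM n v hv
      rw [map_add] at this
      linarith [hbe n]
  -- A nonprincipal ultrafilter keeps every property that holds for all large n.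
  obtain ⟨c, hc⟩ := exists_forall_tendsto_apply_ultrafilter hbC (hyperfilter ℕ)
  have hev : ∀ {p : ℕ → Prop}, (∀ᶠ n in atTop, p n) → ∀ᶠ n in (hyperfilter ℕ : Filter ℕ), p n :=
    fun h => Nat.hyperfilter_le_atTop h
  have hcx : ∀ k, β ≤ c (x k) := fun k => ge_of_tendsto (hc (x k)) <|
    hev <| (eventually_gt_atTop k).mono fun n hn => (hbβ k n hn).le
  obtain ⟨y, hy, z, hz⟩ := hblock x
    (isBounded_iff_forall_norm_le.2 ⟨‖g‖ + 1, by rintro _ ⟨n, rfl⟩; exact hxR n⟩)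
  have hcy : ∀ n, β ≤ c (y n) := hy.mem_of_convex (C := {x | β ≤ c x})
    (convex_halfSpace_ge c.toLinearMap.isLinear β) hcx
  have hyR : ∀ n, y n ∈ Metric.closedBall 0 (‖g‖ + 1) :=
    hy.mem_of_convex (convex_closedBall 0 _) fun n => by simpa using hxR n
  -- Here n tends to infinity with k fixed; the limit in k then gives `hcz`.
  have hbz : ∀ k, b k z ≤ α := fun k =>
    le_of_tendsto (tendsto_apply_of_mem_convexHull (fun b hb => hz b (Or.inl hb)) (hbK k)) <|
      hy.eventually_mem_of_convex (C := {x | b k x ≤ α})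
        (convex_halfSpace_le (b k).toLinearMap.isLinear α) fun n hn => hbα k n hn
  have hcz : c z ≤ α := le_of_tendsto (hc z) (Eventually.of_forall hbz)
  have := nonpos_of_le_apply_of_tendsto_zero hDcomp hatt he
    (fun b hb => by simpa using hM b hb 0 (by simpa using hr.le))
    (f := fun n => y n - z) (R := ‖g‖ + 1 + ‖z‖)
    (fun k => (norm_sub_le _ _).trans (by linarith [mem_closedBall_zero_iff.1 (hyR k)]))
    (fun b hb => by simpa using (hz b hb).sub_const (b z)) c
    (fun x t h => le_of_tendsto (hc x) <|
      Eventually.of_forall fun n => apply_le_of_mem_convexHull h (hbK n))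
    (γ := β - α) (fun k => by rw [map_sub]; linarith [hcy k])
  linarith
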